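/- **Definitions.** An *abstract logic* $\mathcal L$ consists of a set $Expr_{\mathcal L}$ of formulas, a set of operations (connectives) on it, and a non-empty set $Th_{\mathcal L}$ of subsets of $Expr_{\mathcal L}$, called theories, such that $\bigcap\mathcal T\in Th_{\mathcal L}$ for every non-empty $\mathcal T\subseteq Th_{\mathcal L}$. A set of formulas is *consistent* if it is contained in some theory. A theory $T$ is *$\kappa$-prime* ($\kappa\ge\omega$ a cardinal) if for every non-empty $\mathcal T\subseteq Th_{\mathcal L}$ of size $<\kappa$, $T=\bigcap\mathcal T$ implies $T\in\mathcal T$; it is *prime* if it is $\omega$-prime, and *totally prime* if it is $\kappa$-prime for all cardinals $\kappa\ge\omega$. $PTh_{\mathcal L}$ is the set of prime theories. $\mathcal L$ is *closed under chains* if for every ordinal $\alpha>0$ and every chain of theories $(T_i)_{i<\alpha}$ with $T_i\subseteq T_j$ for $i\le j<\alpha$, the union $\bigcup_{i<\alpha}T_i$ is a theory. Formulas $a,b$ are *logically equivalent*, $a=_{\mathcal L}b$, if they lie in the same theories. An *intuitionistic abstract logic* is an abstract logic with $Expr_{\mathcal L}\neq\varnothing$ that is closed under chains and has connectives $\vee,\wedge,\sim,\to$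 such that for all formulas $a,b$ and all totally prime theories $T$: (i) $a\vee b\in T$ iff $a\in T$ or $b\in T$; (ii) $a\wedge b\in T$ iff $a\in T$ and $b\in T$; (iii) $\sim a\in T$ iff $T\cup\{a\}$ is inconsistent; (iv) $a\to b\in T$ iff for all totally prime $T'\supseteq T$, $a\in T'$ implies $b\in T'$. A *logic map* $h:\mathcal L\to\mathcal L'$ is a function $Expr_{\mathcal L}\to Expr_{\mathcal L'}$ with $h^{-1}(T')\in Th_{\mathcal L}$ for all $T'\in Th_{\mathcal L'}$. It is *stable* if also $h^{-1}(P')\in PTh_{\mathcal L}$ for all $P'\in PTh_{\mathcal L'}$. It is a *logic isomorphism* if $\{h^{-1}(T')\mid T'\in Th_{\mathcal L'}\}=Th_{\mathcal L}$ and every $a'\in Expr_{\mathcal L'}$ satisfies $h(a)=_{\mathcal L'}a'$ for some $a\in Expr_{\mathcal L}$. The category $\mathbf{IL}$ has intuitionistic abstract logics as objects and stable logic maps as morphisms, where $h,g:\mathcal L\to\mathcal L'$ are identified if $h(a)=_{\mathcal L'}g(a)$ for all $a$. A *spectral space* is a compact $T_0$ space whose compact open sets form a base closed under finite intersections and in which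 every non-empty irreducible closed set has a generic point; $\Lambda(X)$ denotes the set of compact open subsets of $X$. It is a *spectral space with implication* if for all $U,V\in\Lambda(X)$ the set $U\to V:=\{x\in X\mid \forall y\ge x:\ y\in U\Rightarrow y\in V\}$ is in $\Lambda(X)$, where $x\le y$ iff $\overline{\{x\}}\subseteq\overline{\{y\}}$. A *spectral map* is a continuous map for which inverse images of compact open sets are compact. The category $\mathbf{SI}$ has non-empty spectral spaces with implication as objects and spectral maps as morphisms. For $\mathcal L$ in $\mathbf{IL}$ let $\mathcal F(\mathcal L):=PTh_{\mathcal L}$ with the topology generated by the sets $a^{PTh_{\mathcal L}}:=\{P\in PTh_{\mathcal L}\mid a\in P\}$, $a\in Expr_{\mathcal L}$, and for $h:\mathcal L\to\mathcal L'$ let $\mathcal F(h)(P'):=h^{-1}(P')$. For $X$ in $\mathbf{SI}$ and $x\in X$ let $x^{\Lambda(X)}:=\{U\in\Lambda(X)\mid x\in U\}$, and let $\mathcal G(X)$ be the logic with formulas $\Lambda(X)$, with theories the intersections $\bigcap A$ of non-empty sets $A\subseteq\{x^{\Lambda(X)}\mid x\in X\}$, and with connectives $\cup,\cap,\sim,\to$,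 where $\sim U:=U\to\varnothing$; for $f:X\to X'$ let $\mathcal G(f)(U'):=f^{-1}(U')$. **Theorem.** $\mathcal F:\mathbf{IL}\to\mathbf{SI}$ and $\mathcal G:\mathbf{SI}\to\mathbf{IL}$ are well-defined contravariant functors. For every $\mathcal L$ in $\mathbf{IL}$ the sets $a^{PTh_{\mathcal L}}$ form a base of $PTh_{\mathcal L}$ and are exactly its compact open sets. The categories $\mathbf{IL}$ and $\mathbf{SI}$ are dually equivalent via $\mathcal F$ and $\mathcal G$. The maps $\tau_{\mathcal L}:\mathcal L\to\mathcal G(\mathcal F(\mathcal L))$, $a\mapsto a^{PTh_{\mathcal L}}$, are logic isomorphisms and form a natural isomorphism $1_{\mathbf{IL}}\cong\mathcal G\circ\mathcal F$; the maps $\sigma_X:X\to\mathcal F(\mathcal G(X))$, $x\mapsto x^{\Lambda(X)}$, are homeomorphisms and form a natural isomorphism $1_{\mathbf{SI}}\cong\mathcal F\circ\mathcal G$. -/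

import Mathlib

open CategoryTheory TopologicalSpace Opposite

universe u

/-! ## Abstract logics -/

/-- An abstract logic: a set of expressions and a non-empty family of subsets, the theories, closed
under intersections of non-empty subfamilies. The connectives are added in `IL` below. -/
structure AbstractLogic : Type (u + 1) where
  Expr : Type u
  Th : Set (Set Expr)
  th_nonempty : Th.Nonempty
  sInter_mem : ∀ 𝒯 : Set (Set Expr), 𝒯 ⊆ Th → 𝒯.Nonempty → ⋂₀ 𝒯 ∈ Th

namespace AbstractLogic

/-- `A` is contained in some theory. -/
def Consistent (L : AbstractLogic.{u}) (A : Set L.Expr) : Prop :=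
  ∃ T ∈ L.Th, A ⊆ T

/-- The consequence relation `A ⊩ a`. If `A` is inconsistent then every `a` is a consequence. -/
def Entails (L : AbstractLogic.{u}) (A : Set L.Expr) (a : L.Expr) : Prop :=
  a ∈ ⋂₀ {T | T ∈ L.Th ∧ A ⊆ T}

/-- Logical equivalence `a =_L b`. -/
def LogEquiv (L : AbstractLogic.{u}) (a b : L.Expr) : Prop :=
  L.Entails {a} b ∧ L.Entails {b} a

/-- `κ`-prime theories. -/
def IsKappaPrime (L : AbstractLogic.{u}) (κ : Cardinal.{u}) (T : Set L.Expr) : Prop :=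
  T ∈ L.Th ∧ ∀ 𝒯 : Set (Set L.Expr), 𝒯 ⊆ L.Th → 𝒯.Nonempty → Cardinal.mk 𝒯 < κ →
    T = ⋂₀ 𝒯 → T ∈ 𝒯

/-- Prime theories are the `ω`-prime ones. -/
def IsPrime (L : AbstractLogic.{u}) (T : Set L.Expr) : Prop :=
  L.IsKappaPrime Cardinal.aleph0 T

/-- Totally prime theories: `κ`-prime for all infinite cardinals `κ`. -/
def IsTotallyPrime (L : AbstractLogic.{u}) (T : Set L.Expr) : Prop :=
  ∀ κ : Cardinal.{u}, Cardinal.aleph0 ≤ κ → L.IsKappaPrime κ T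

/-- The union of every non-empty well-ordered increasing chain of theories is a theory. -/
def ClosedUnderChains (L : AbstractLogic.{u}) : Prop :=
  ∀ α : Ordinal.{u}, 0 < α → ∀ T : Set.Iio α → Set L.Expr,
    (∀ i, T i ∈ L.Th) → Monotone T → (⋃ i, T i) ∈ L.Th

/-- The logic `L` together with the operations `or`, `and`, `neg`, `imp` is an intuitionistic
abstract logic. -/
structure IsIntuitionistic (L : AbstractLogic.{u}) (or and : L.Expr → L.Expr → L.Expr)
    (neg : L.Expr → L.Expr) (imp : L.Expr → L.Expr → L.Expr) : Prop where
  closedUnderChains : L.ClosedUnderChains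
  or_mem_iff : ∀ a b T, L.IsTotallyPrime T → (or a b ∈ T ↔ a ∈ T ∨ b ∈ T)
  and_mem_iff : ∀ a b T, L.IsTotallyPrime T → (and a b ∈ T ↔ a ∈ T ∧ b ∈ T)
  neg_mem_iff : ∀ a T, L.IsTotallyPrime T → (neg a ∈ T ↔ ¬ L.Consistent (T ∪ {a}))
  imp_mem_iff : ∀ a b T, L.IsTotallyPrime T →
    (imp a b ∈ T ↔ ∀ T', L.IsTotallyPrime T' → T ⊆ T' → a ∈ T' → b ∈ T')

/-- The set `PTh_L` of prime theories, the carrier of the space of the logic. -/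
def Space (L : AbstractLogic.{u}) : Type u := {T : Set L.Expr // L.IsPrime T}

/-- A point of `PTh_L`, viewed as a set of formulas. -/
def Space.theory {L : AbstractLogic.{u}} (P : L.Space) : Set L.Expr := P.1

/-- The set `a^X` of the prime theories containing `a`, where `X = PTh_L`. -/
def basicOpen (L : AbstractLogic.{u}) (a : L.Expr) : Set L.Space := {P | a ∈ P.theory}

/-- The topology on `PTh_L` generated by the sets `a^X`. -/
instance (L : AbstractLogic.{u}) : TopologicalSpace L.Space :=
  TopologicalSpace.generateFrom (Set.range L.basicOpen)

/-- `h` is a logic map: preimages of theories are theories. -/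
def IsLogicMap (L L' : AbstractLogic.{u}) (h : L.Expr → L'.Expr) : Prop :=
  ∀ T' ∈ L'.Th, h ⁻¹' T' ∈ L.Th

/-- Stable logic maps: preimages of prime theories are prime theories. -/
structure IsStable (L L' : AbstractLogic.{u}) (h : L.Expr → L'.Expr) : Prop where
  isLogicMap : IsLogicMap L L' h
  isPrime_preimage : ∀ P', L'.IsPrime P' → L.IsPrime (h ⁻¹' P')

/-- Logic isomorphisms: logic maps that are normal and surjective up to logical equivalence. -/
structure IsLogicIso (L L' : AbstractLogic.{u}) (h : L.Expr → L'.Expr) : Prop where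
  isLogicMap : IsLogicMap L L' h
  normal : {T | ∃ T' ∈ L'.Th, T = h ⁻¹' T'} = L.Th
  surjective : ∀ a', ∃ a, L'.LogEquiv (h a) a'

theorem LogEquiv.mem_iff {L : AbstractLogic.{u}} {a b : L.Expr} (h : L.LogEquiv a b)
    {T : Set L.Expr} (hT : T ∈ L.Th) : a ∈ T ↔ b ∈ T :=
  ⟨fun ha => h.1 T ⟨hT, Set.singleton_subset_iff.2 ha⟩,
    fun hb => h.2 T ⟨hT, Set.singleton_subset_iff.2 hb⟩⟩

theorem logEquiv_of_forall {L : AbstractLogic.{u}} {a b : L.Expr}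
    (h : ∀ T ∈ L.Th, a ∈ T ↔ b ∈ T) : L.LogEquiv a b :=
  ⟨fun T hT => (h T hT.1).1 (hT.2 rfl), fun T hT => (h T hT.1).2 (hT.2 rfl)⟩

end AbstractLogic

/-! ## The category of intuitionistic abstract logics -/

/-- Intuitionistic abstract logics (with a non-empty set of formulas). -/
structure IL : Type (u + 1) extends AbstractLogic.{u} where
  or : Expr → Expr → Expr
  and : Expr → Expr → Expr
  neg : Expr → Expr
  imp : Expr → Expr → Expr
  expr_nonempty : Nonempty Expr
  isIntuitionistic : toAbstractLogic.IsIntuitionistic or and neg imp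

namespace IL

/-- Stable logic maps between intuitionistic abstract logics. -/
def StableMap (L L' : IL.{u}) : Type u :=
  {h : L.Expr → L'.Expr // AbstractLogic.IsStable L.toAbstractLogic L'.toAbstractLogic h}

/-- Two stable maps are identified if they agree up to logical equivalence, that is, if they
induce the same map on formulas modulo logical equivalence. -/
instance stableMapSetoid (L L' : IL.{u}) : Setoid (StableMap L L') where
  r h g := ∀ a, L'.LogEquiv (h.1 a) (g.1 a)
  iseqv :=
    { refl := fun _ _ => AbstractLogic.logEquiv_of_forall fun _ _ => Iff.rfl
      symm := fun hg a => ⟨(hg a).2, (hg a).1⟩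
      trans := fun h₁ h₂ a => AbstractLogic.logEquiv_of_forall fun _ hT =>
        ((h₁ a).mem_iff hT).trans ((h₂ a).mem_iff hT) }

def StableMap.id (L : IL.{u}) : StableMap L L :=
  ⟨fun a => a, ⟨fun _ hT => hT, fun _ hP => hP⟩⟩

def StableMap.comp {L L' L'' : IL.{u}} (h : StableMap L L') (g : StableMap L' L'') :
    StableMap L L'' :=
  ⟨fun a => g.1 (h.1 a),
    ⟨fun T hT => h.2.isLogicMap _ (g.2.isLogicMap T hT),
      fun P hP => h.2.isPrime_preimage _ (g.2.isPrime_preimage P hP)⟩⟩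

/-- Morphisms: stable logic maps modulo pointwise logical equivalence. -/
instance : Category.{u} IL.{u} where
  Hom L L' := Quotient (stableMapSetoid L L')
  id L := Quotient.mk _ (StableMap.id L)
  comp f g := Quotient.map₂ StableMap.comp
    (fun h _ hh g g' hg a => AbstractLogic.logEquiv_of_forall fun T hT =>
      ((hh a).mem_iff (g.2.isLogicMap T hT)).trans ((hg _).mem_iff hT)) f g
  id_comp f := by induction f using Quotient.ind; rfl
  comp_id f := by induction f using Quotient.ind; rfl
  assoc f g h := by
    induction f using Quotient.ind
    induction g using Quotient.ind
    induction h using Quotient.ind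
    rfl

/-- The morphism represented by a stable logic map. -/
def StableMap.toHom {L L' : IL.{u}} (h : StableMap L L') : L ⟶ L' := Quotient.mk _ h

/-- The inverse complement of a stable map on prime theories, `P' ↦ h⁻¹(P')`. -/
def StableMap.pullback {L L' : IL.{u}} (h : StableMap L L') : L'.Space → L.Space :=
  fun P' => ⟨h.1 ⁻¹' P'.1, h.2.isPrime_preimage _ P'.2⟩

end IL

/-! ## The category of spectral spaces with implication -/

/-- The set `U → V = {x | ∀ y ≥ x, y ∈ U → y ∈ V}`, where `x ≤ y` is the specialization order
given by `closure {x} ⊆ closure {y}`, which is `y ⤳ x` in the notation of Mathlib. -/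
def impSet {X : Type u} [TopologicalSpace X] (U V : Set X) : Set X :=
  {x | ∀ y, y ⤳ x → y ∈ U → y ∈ V}

/-- Spectral spaces with implication: for compact open `U`, `V`, the set `U → V` is compact open. -/
class ImplicativeSpectralSpace (X : Type u) [TopologicalSpace X] : Prop extends
    SpectralSpace X where
  isCompact_impSet : ∀ U V : CompactOpens X, IsCompact (impSet (U : Set X) (V : Set X))
  isOpen_impSet : ∀ U V : CompactOpens X, IsOpen (impSet (U : Set X) (V : Set X))

/-- Non-empty spectral spaces with implication. -/
structure SI : Type (u + 1) where
  carrier : Type u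
  [top : TopologicalSpace carrier]
  [nonempty : Nonempty carrier]
  [spectral : ImplicativeSpectralSpace carrier]

namespace SI

attribute [instance] SI.top SI.nonempty SI.spectral

/-- Morphisms are the spectral maps. -/
instance : Category.{u} SI.{u} where
  Hom X Y := SpectralMap X.carrier Y.carrier
  id X := SpectralMap.id X.carrier
  comp f g := SpectralMap.comp g f

/-- The map underlying a morphism. -/
def toMap {X Y : SI.{u}} (f : X ⟶ Y) : X.carrier → Y.carrier := SpectralMap.toFun f

/-- The lattice `Λ(X)` of compact open sets. -/
abbrev Lam (X : SI.{u}) : Type u := CompactOpens X.carrier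

/-- The set `x^Λ(X)` of the compact open sets containing `x`. -/
def pointFilter (X : SI.{u}) (x : X.carrier) : Set X.Lam := {U | x ∈ U}

/-- The disjunction `U ∪ V`. -/
def union (X : SI.{u}) (U V : X.Lam) : X.Lam := U ⊔ V

/-- The conjunction `U ∩ V`. -/
def inter (X : SI.{u}) (U V : X.Lam) : X.Lam := U ⊓ V

/-- The implication `U → V` as an element of `Λ(X)`. -/
def imp (X : SI.{u}) (U V : X.Lam) : X.Lam where
  carrier := impSet (U : Set X.carrier) (V : Set X.carrier)
  isCompact' := ImplicativeSpectralSpace.isCompact_impSet U V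
  isOpen' := ImplicativeSpectralSpace.isOpen_impSet U V

/-- The negation `U → ∅`. -/
def neg (X : SI.{u}) (U : X.Lam) : X.Lam := X.imp U ⊥

/-- The abstract logic on `Λ(X)` whose theories are the intersections of non-empty sets of the
filters `x^Λ(X)`. -/
def logic (X : SI.{u}) : AbstractLogic.{u} where
  Expr := X.Lam
  Th := {T | ∃ A : Set (Set X.Lam), A ⊆ Set.range X.pointFilter ∧ A.Nonempty ∧ T = ⋂₀ A}
  th_nonempty := by
    obtain ⟨x⟩ := X.nonempty
    exact ⟨_, {X.pointFilter x}, by simp, Set.singleton_nonempty _, rfl⟩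
  sInter_mem 𝒯 h𝒯 hne := by
    refine ⟨{P | P ∈ Set.range X.pointFilter ∧ ⋂₀ 𝒯 ⊆ P}, fun P hP => hP.1, ?_, ?_⟩
    · obtain ⟨T, hT⟩ := hne
      obtain ⟨A, hA, ⟨P, hP⟩, rfl⟩ := h𝒯 hT
      exact ⟨P, hA hP, fun U hU => hU _ hT P hP⟩
    · refine Set.Subset.antisymm (fun U hU P hP => hP.2 hU) fun U hU T hT => ?_
      obtain ⟨A, hA, -, rfl⟩ := h𝒯 hT
      exact fun P hP => hU P ⟨hA hP, fun V hV => hV _ hT P hP⟩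

/-- A formula of the logic of `X`, viewed as a subset of `X`. -/
def extent (X : SI.{u}) (U : X.logic.Expr) : Set X.carrier :=
  SetLike.coe (show CompactOpens X.carrier from U)

/-- The preimage map `U' ↦ f⁻¹(U')` on compact open sets. -/
def preimage {X X' : SI.{u}} (f : X ⟶ X') (U' : X'.Lam) : X.Lam where
  carrier := SI.toMap f ⁻¹' (U' : Set X'.carrier)
  isCompact' := (SpectralMap.spectral' f).isCompact_preimage_of_isOpen U'.isOpen U'.isCompact
  isOpen' := U'.isOpen.preimage (SpectralMap.spectral' f).continuous

end SI

/-! ## The two contravariant functors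

The definitions take as arguments the facts which make the assignments well defined; these facts
are part of what the main theorem asserts. -/

/-- The functor `L ↦ PTh_L`, `h ↦ (P' ↦ h⁻¹(P'))`. -/
def spaceFunctor
    (hne : ∀ L : IL.{u}, Nonempty L.Space)
    (hsp : ∀ L : IL.{u}, ImplicativeSpectralSpace L.Space)
    (hmap : ∀ (L L' : IL.{u}) (h : IL.StableMap L L'), IsSpectralMap h.pullback) :
    IL.{u}ᵒᵖ ⥤ SI.{u} where
  obj L := @SI.mk L.unop.Space _ (hne L.unop) (hsp L.unop)
  map {_ _} h := Quotient.lift (fun g : IL.StableMap _ _ => SpectralMap.mk g.pullback (hmap _ _ g))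
    (fun g g' hg => by
      congr 1
      funext P
      exact Subtype.ext (Set.ext fun a => (hg a).mem_iff P.2.1)) h.unop
  map_id _ := rfl
  map_comp f g := by
    obtain ⟨f⟩ := f
    obtain ⟨g⟩ := g
    induction f using Quotient.ind
    induction g using Quotient.ind
    rfl

/-- The functor `X ↦ (Λ(X), Th, ∪, ∩, →, ∼)`, `f ↦ (U' ↦ f⁻¹(U'))`. -/
def logicFunctor
    (hint : ∀ X : SI.{u}, X.logic.IsIntuitionistic X.union X.inter X.neg X.imp)
    (hmap : ∀ (X X' : SI.{u}) (f : X ⟶ X'),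
      AbstractLogic.IsStable X'.logic X.logic (SI.preimage f)) :
    SI.{u} ⥤ IL.{u}ᵒᵖ where
  obj X := op
    { toAbstractLogic := X.logic
      or := X.union
      and := X.inter
      neg := X.neg
      imp := X.imp
      expr_nonempty := ⟨(⊥ : X.Lam)⟩
      isIntuitionistic := hint X }
  map {X X'} f := Quiver.Hom.op (IL.StableMap.toHom ⟨SI.preimage f, hmap X X' f⟩)
  map_id _ := rfl
  map_comp _ _ := rfl

/-! ## Theories of abstract logics closed under chains -/

namespace AbstractLogic

variable {L : AbstractLogic.{u}}

/-! This is Stone duality with theories in the role of filters. Closure under chains makes Zorn's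
lemma available: a theory maximal among those omitting a formula is totally prime, so every theory
is the intersection of the totally prime theories above it. The clauses for connectives, imposed
only at totally prime theories, therefore spread: conjunction and implication to all theories
(`IL.and_mem_iff`, `IL.imp_mem_iff`), disjunction to prime theories (`IL.or_mem_iff`). Moreover
every proper filter is a theory (`IL.mem_th_of_isFilter`) and every theory with the disjunction
property is prime (`IL.isPrime_of_or_mem`). The usual prime-filter arguments then give compactness
and sobriety of the space of a logic.

Conversely, compactness of the constructible topology shows that the logic of a space has the proper
filters of compact opens as theories (`SI.mem_th_iff`) and the filters of points as prime theories
(`SI.isPrime_logic_iff`). Thus points and prime theories correspond, and compact opens correspond to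
formulas modulo equivalence. Stable maps need not preserve connectives, so spectral maps need no
compatibility with implication. -/

theorem ClosedUnderChains.sUnion_mem (hL : L.ClosedUnderChains) {c : Set (Set L.Expr)}
    (hc : c ⊆ L.Th) (hchain : IsChain (· ⊆ ·) c) (hne : c.Nonempty) : ⋃₀ c ∈ L.Th := by
  classical
  obtain ⟨T₀, hT₀⟩ := hne
  -- The records of a well-ordering of `c` form a well-ordered cofinal subset of `c`.
  let r : c → c → Prop := WellOrderingRel
  have hr : IsWellFounded c r := inferInstance
  let s : Set c := {a | ∀ b, r b a → b.1 ⊂ a.1}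
  have hcof : ∀ a : c, ∃ b ∈ s, a.1 ⊆ b.1 := by
    intro a
    obtain ⟨b, hb, hb'⟩ := hr.wf.has_min {b : c | a.1 ⊆ b.1} ⟨a, subset_refl a.1⟩
    refine ⟨b, fun d hd => ?_, hb⟩
    by_contra hbd
    have hne : b.1 ⊆ d.1 := by
      rcases hchain.total d.2 b.2 with h | h
      · by_contra h'
        exact hbd ⟨h, h'⟩
      · exact h
    exact hb' d (hb.trans hne) hd
  let r' : s → s → Prop := fun a b => r a.1 b.1
  have : IsWellOrder s r' := (RelEmbedding.preimage (Function.Embedding.subtype _) r).isWellOrder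
  let e := Ordinal.enum r'
  have hpos : 0 < Ordinal.type r' := by
    obtain ⟨b, hb, -⟩ := hcof ⟨T₀, hT₀⟩
    have : Nonempty s := ⟨⟨b, hb⟩⟩
    exact pos_iff_ne_zero.2 (Ordinal.type_ne_zero_of_nonempty _)
  have hmem := hL (Ordinal.type r') hpos (fun i => (e i).1.1) (fun i => hc (e i).1.2) (by
    intro i j hij
    rcases hij.eq_or_lt with rfl | hlt
    · exact le_rfl
    · exact ((e j).2 _ (e.map_rel_iff.2 hlt)).1)
  convert hmem using 1
  refine Set.Subset.antisymm ?_ (Set.iUnion_subset fun i => Set.subset_sUnion_of_mem (e i).1.2)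
  refine Set.sUnion_subset fun T hT => ?_
  obtain ⟨b, hb, hTb⟩ := hcof ⟨T, hT⟩
  refine hTb.trans (Set.subset_iUnion_of_subset (e.symm ⟨b, hb⟩) ?_)
  simp

/-- Zorn's lemma for theories omitting a set of formulas. -/
theorem ClosedUnderChains.exists_maximal_disjoint (hL : L.ClosedUnderChains) {T J : Set L.Expr}
    (hT : T ∈ L.Th) (hJ : Disjoint T J) :
    ∃ M, T ⊆ M ∧ Maximal (fun M => M ∈ L.Th ∧ Disjoint M J) M := by
  refine zorn_subset_nonempty {M | M ∈ L.Th ∧ Disjoint M J} ?_ T ⟨hT, hJ⟩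
  intro c hc hchain hne
  exact ⟨⋃₀ c, ⟨hL.sUnion_mem (fun T hT => (hc hT).1) hchain hne,
    Set.disjoint_sUnion_left.2 fun T hT => (hc hT).2⟩, fun T hT => Set.subset_sUnion_of_mem hT⟩

/-- Maximality among theories omitting `c` forces total primeness: in any decomposition of `M` some
member omits `c`, and it contains `M`, so it equals `M`. -/
theorem ClosedUnderChains.exists_isTotallyPrime_notMem (hL : L.ClosedUnderChains)
    {T : Set L.Expr} (hT : T ∈ L.Th) {c : L.Expr} (hc : c ∉ T) :
    ∃ M, L.IsTotallyPrime M ∧ T ⊆ M ∧ c ∉ M := by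
  obtain ⟨M, hTM, hM⟩ := hL.exists_maximal_disjoint hT (Set.disjoint_singleton_right.2 hc)
  have hcM : c ∉ M := Set.disjoint_singleton_right.1 hM.prop.2
  refine ⟨M, fun κ _ => ⟨hM.prop.1, fun 𝒯 h𝒯 _ _ heq => ?_⟩, hTM, hcM⟩
  have : ∃ T' ∈ 𝒯, c ∉ T' := by
    by_contra! h
    exact hcM (heq ▸ h)
  obtain ⟨T', hT', hcT'⟩ := this
  have hMT' : M ⊆ T' := heq ▸ Set.sInter_subset_of_mem hT'
  rw [hM.eq_of_subset ⟨h𝒯 hT', Set.disjoint_singleton_right.2 hcT'⟩ hMT']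
  exact hT'

theorem IsKappaPrime.mem_th {κ : Cardinal.{u}} {T : Set L.Expr} (h : L.IsKappaPrime κ T) :
    T ∈ L.Th := h.1

theorem IsTotallyPrime.isPrime {T : Set L.Expr} (h : L.IsTotallyPrime T) : L.IsPrime T :=
  h _ le_rfl

theorem IsTotallyPrime.mem_th {T : Set L.Expr} (h : L.IsTotallyPrime T) : T ∈ L.Th :=
  h.isPrime.1

/-- A totally prime theory lies in every non-empty family of theories of which it is the
intersection. -/
theorem IsTotallyPrime.mem_of_eq_sInter {T : Set L.Expr} (h : L.IsTotallyPrime T)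
    {𝒯 : Set (Set L.Expr)} (h𝒯 : 𝒯 ⊆ L.Th) (hne : 𝒯.Nonempty) (heq : T = ⋂₀ 𝒯) : T ∈ 𝒯 :=
  (h (max Cardinal.aleph0 (Order.succ (Cardinal.mk 𝒯))) (le_max_left _ _)).2 𝒯 h𝒯 hne
    (lt_max_of_lt_right (Order.lt_succ _)) heq

theorem isPrime_iff {T : Set L.Expr} : L.IsPrime T ↔ T ∈ L.Th ∧ ∀ 𝒯 : Set (Set L.Expr),
    𝒯 ⊆ L.Th → 𝒯.Nonempty → 𝒯.Finite → T = ⋂₀ 𝒯 → T ∈ 𝒯 := by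
  simp only [IsPrime, IsKappaPrime, Cardinal.lt_aleph0_iff_set_finite]

end AbstractLogic

/-! ## Theories of intuitionistic logics -/

namespace IL

variable {L : IL.{u}} {T P : Set L.Expr} {a b c : L.Expr}

theorem exists_isTotallyPrime_notMem (hT : T ∈ L.Th) (hc : c ∉ T) :
    ∃ M, L.IsTotallyPrime M ∧ T ⊆ M ∧ c ∉ M :=
  L.isIntuitionistic.closedUnderChains.exists_isTotallyPrime_notMem hT hc

theorem mem_of_forall_isTotallyPrime (hT : T ∈ L.Th)
    (h : ∀ M, L.IsTotallyPrime M → T ⊆ M → c ∈ M) : c ∈ T := by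
  by_contra hc
  obtain ⟨M, hM, hTM, hcM⟩ := exists_isTotallyPrime_notMem hT hc
  exact hcM (h M hM hTM)

theorem and_mem_iff (hT : T ∈ L.Th) : L.and a b ∈ T ↔ a ∈ T ∧ b ∈ T := by
  constructor
  · exact fun h => ⟨mem_of_forall_isTotallyPrime hT fun M hM hTM =>
      ((L.isIntuitionistic.and_mem_iff a b M hM).1 (hTM h)).1,
      mem_of_forall_isTotallyPrime hT fun M hM hTM =>
      ((L.isIntuitionistic.and_mem_iff a b M hM).1 (hTM h)).2⟩
  · exact fun h => mem_of_forall_isTotallyPrime hT fun M hM hTM =>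
      (L.isIntuitionistic.and_mem_iff a b M hM).2 ⟨hTM h.1, hTM h.2⟩

theorem or_mem_of_mem (hT : T ∈ L.Th) (h : a ∈ T ∨ b ∈ T) : L.or a b ∈ T :=
  mem_of_forall_isTotallyPrime hT fun M hM hTM =>
    (L.isIntuitionistic.or_mem_iff a b M hM).2 (h.imp (@hTM _) (@hTM _))

/-- The deduction theorem. -/
theorem imp_mem_iff (hT : T ∈ L.Th) :
    L.imp a b ∈ T ↔ ∀ T' ∈ L.Th, T ⊆ T' → a ∈ T' → b ∈ T' := by
  constructor
  · exact fun h T' hT' hTT' ha => mem_of_forall_isTotallyPrime hT' fun M hM hTM =>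
      (L.isIntuitionistic.imp_mem_iff a b M hM).1 (hTM (hTT' h)) M hM subset_rfl (hTM ha)
  · exact fun h => mem_of_forall_isTotallyPrime hT fun M hM hTM =>
      (L.isIntuitionistic.imp_mem_iff a b M hM).2 fun M' hM' hMM' ha =>
        h M' hM'.mem_th (hTM.trans hMM') ha

theorem imp_self_mem (hT : T ∈ L.Th) : L.imp a a ∈ T :=
  (imp_mem_iff hT).2 fun _ _ _ h => h

/-- Were the full set a theory, it would be totally prime, and containing a negation it would have
to be inconsistent. Hence every theory is proper. -/
theorem univ_notMem_th : Set.univ ∉ L.Th := by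
  intro h
  obtain ⟨a⟩ := L.expr_nonempty
  have hprime : L.IsTotallyPrime Set.univ := by
    refine fun κ _ => ⟨h, fun 𝒯 _ ⟨T, hT⟩ _ heq => ?_⟩
    have hTu : T = Set.univ := Set.univ_subset_iff.1 (heq ▸ Set.sInter_subset_of_mem hT)
    exact hTu ▸ hT
  exact (L.isIntuitionistic.neg_mem_iff a _ hprime).1 (Set.mem_univ _)
    ⟨_, h, Set.subset_univ _⟩

theorem exists_isTotallyPrime_superset (hT : T ∈ L.Th) : ∃ M, L.IsTotallyPrime M ∧ T ⊆ M := by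
  obtain ⟨c, hc⟩ := (Set.ne_univ_iff_exists_notMem T).1
    fun h => univ_notMem_th (h ▸ hT)
  obtain ⟨M, hM, hTM, -⟩ := exists_isTotallyPrime_notMem hT hc
  exact ⟨M, hM, hTM⟩

/-- A contradiction. -/
noncomputable def bot (L : IL.{u}) : L.Expr :=
  L.and L.expr_nonempty.some (L.neg L.expr_nonempty.some)

theorem bot_notMem (hT : T ∈ L.Th) : L.bot ∉ T := by
  intro h
  obtain ⟨M, hM, hTM⟩ := exists_isTotallyPrime_superset hT
  have h' := (and_mem_iff hM.mem_th).1 (hTM h)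
  exact (L.isIntuitionistic.neg_mem_iff _ M hM).1 h'.2
    ⟨M, hM.mem_th, Set.union_subset subset_rfl (Set.singleton_subset_iff.2 h'.1)⟩

/-! ### Prime theories and filters -/

theorem exists_mem_sInter_of_finite {J : Set L.Expr} (hJ : ∀ a ∈ J, ∀ b ∈ J, L.or a b ∈ J)
    (hJne : J.Nonempty) {𝒯 : Set (Set L.Expr)} (hfin : 𝒯.Finite) (h𝒯 : 𝒯 ⊆ L.Th)
    (hmeet : ∀ T ∈ 𝒯, (T ∩ J).Nonempty) : ∃ j ∈ J, ∀ T ∈ 𝒯, j ∈ T := by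
  induction 𝒯, hfin using Set.Finite.induction_on with
  | empty => exact ⟨_, hJne.some_mem, by simp⟩
  | @insert T 𝒯 _ _ ih =>
    obtain ⟨j, hj, hj'⟩ := ih (fun _ h => h𝒯 (Or.inr h)) fun _ h => hmeet _ (Or.inr h)
    obtain ⟨k, hkT, hkJ⟩ := hmeet T (Or.inl rfl)
    refine ⟨L.or j k, hJ j hj k hkJ, ?_⟩
    rintro T' (rfl | hT')
    · exact or_mem_of_mem (h𝒯 (Or.inl rfl)) (Or.inr hkT)
    · exact or_mem_of_mem (h𝒯 (Or.inr hT')) (Or.inl (hj' T' hT'))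

/-- A theory is prime if it omits a set closed under disjunctions which all the larger members of
each of its finite decompositions meet. -/
theorem isPrime_of_forall_meet {J : Set L.Expr} (hJ : ∀ a ∈ J, ∀ b ∈ J, L.or a b ∈ J)
    (hJne : J.Nonempty) (hT : T ∈ L.Th) (hdisj : Disjoint T J)
    (hmeet : ∀ T' ∈ L.Th, T ⊆ T' → T ≠ T' → (T' ∩ J).Nonempty) : L.IsPrime T := by
  refine AbstractLogic.isPrime_iff.2 ⟨hT, fun 𝒯 h𝒯 _ hfin heq => ?_⟩
  by_contra hnot
  obtain ⟨j, hj, hj'⟩ := exists_mem_sInter_of_finite hJ hJne hfin h𝒯 fun T' hT' =>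
    hmeet T' (h𝒯 hT') (heq ▸ Set.sInter_subset_of_mem hT') fun h => hnot (h ▸ hT')
  exact Set.disjoint_left.1 hdisj (heq ▸ hj') hj

/-- The analogue of the prime ideal theorem: a theory maximal among those disjoint from `J` is
prime, because all strictly larger theories meet `J`. Downward closure of `J` is not needed. -/
theorem exists_isPrime_disjoint {J : Set L.Expr} (hJ : ∀ a ∈ J, ∀ b ∈ J, L.or a b ∈ J)
    (hJne : J.Nonempty) (hT : T ∈ L.Th) (hdisj : Disjoint T J) :
    ∃ P, L.IsPrime P ∧ T ⊆ P ∧ Disjoint P J := by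
  obtain ⟨M, hTM, hM⟩ :=
    L.isIntuitionistic.closedUnderChains.exists_maximal_disjoint hT hdisj
  refine ⟨M, isPrime_of_forall_meet hJ hJne hM.prop.1 hM.prop.2 fun T' hT' hMT' hne => ?_, hTM,
    hM.prop.2⟩
  by_contra h
  exact hne (hM.eq_of_subset
    ⟨hT', Set.disjoint_iff_inter_eq_empty.2 (Set.not_nonempty_iff_eq_empty.1 h)⟩ hMT')

/-- Theories with the disjunction property are prime. -/
theorem isPrime_of_or_mem (hT : T ∈ L.Th) (h : ∀ a b, L.or a b ∈ T → a ∈ T ∨ b ∈ T) :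
    L.IsPrime T := by
  refine isPrime_of_forall_meet (J := Tᶜ)
    (fun a ha b hb hab => (h a b hab).elim ha hb) ⟨L.bot, bot_notMem hT⟩ hT
    disjoint_compl_right fun T' _ hTT' hne => ?_
  obtain ⟨a, ha, ha'⟩ := Set.exists_of_ssubset (hTT'.ssubset_of_ne hne)
  exact ⟨a, ha, ha'⟩

/-- Every totally prime extension of `P` contains `a` or `b`, so `P` is the intersection of the
theories generated by adding `a` and by adding `b`. Primeness makes `P` equal to one of them. -/
theorem or_mem_iff (hP : L.IsPrime P) : L.or a b ∈ P ↔ a ∈ P ∨ b ∈ P := by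
  refine ⟨fun h => ?_, or_mem_of_mem hP.mem_th⟩
  let 𝒯 : L.Expr → Set (Set L.Expr) := fun x => {T | T ∈ L.Th ∧ P ⊆ T ∧ x ∈ T}
  have key : P = ⋂₀ (𝒯 a ∪ 𝒯 b) := by
    refine Set.Subset.antisymm (fun x hx T hT => ?_) fun x hx => ?_
    · rcases hT with hT | hT <;> exact hT.2.1 hx
    · refine mem_of_forall_isTotallyPrime hP.mem_th fun M hM hPM => ?_
      rcases (L.isIntuitionistic.or_mem_iff a b M hM).1 (hPM h) with h' | h'
      · exact hx M (Or.inl ⟨hM.mem_th, hPM, h'⟩)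
      · exact hx M (Or.inr ⟨hM.mem_th, hPM, h'⟩)
  -- The non-empty ones among the two families give a finite decomposition of `P`.
  have hmem := (AbstractLogic.isPrime_iff.1 hP).2
    {T | ∃ x, (x = a ∨ x = b) ∧ (𝒯 x).Nonempty ∧ T = ⋂₀ 𝒯 x} ?_ ?_ ?_ ?_
  · obtain ⟨x, hx, -, heq⟩ := hmem
    have hxP : x ∈ P := by
      rw [heq]
      exact fun T hT => hT.2.2
    rcases hx with rfl | rfl
    · exact Or.inl hxP
    · exact Or.inr hxP
  · rintro _ ⟨x, -, hne, rfl⟩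
    exact L.sInter_mem _ (fun T hT => hT.1) hne
  · obtain ⟨M, hM, hPM⟩ := exists_isTotallyPrime_superset hP.mem_th
    rcases (L.isIntuitionistic.or_mem_iff a b M hM).1 (hPM h) with h' | h'
    · exact ⟨_, a, Or.inl rfl, ⟨M, hM.mem_th, hPM, h'⟩, rfl⟩
    · exact ⟨_, b, Or.inr rfl, ⟨M, hM.mem_th, hPM, h'⟩, rfl⟩
  · refine (Set.toFinite {⋂₀ 𝒯 a, ⋂₀ 𝒯 b}).subset ?_
    rintro _ ⟨x, rfl | rfl, -, rfl⟩ <;> simp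
  · refine Set.Subset.antisymm ?_ fun x hx => ?_
    · rintro x hx _ ⟨y, -, -, rfl⟩
      exact fun T hT => hT.2.1 hx
    · rw [key]
      rintro T (hT | hT)
      · exact hx _ ⟨a, Or.inl rfl, ⟨T, hT⟩, rfl⟩ T hT
      · exact hx _ ⟨b, Or.inr rfl, ⟨T, hT⟩, rfl⟩ T hT

/-- Proper filters are theories. -/
theorem mem_th_of_isFilter {F : Set L.Expr} (hne : F.Nonempty) (hbot : L.bot ∉ F)
    (hand : ∀ a ∈ F, ∀ b ∈ F, L.and a b ∈ F)
    (hup : ∀ a ∈ F, ∀ b, (∀ T ∈ L.Th, a ∈ T → b ∈ T) → b ∈ F) : F ∈ L.Th := by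
  have key : ∀ c ∉ F, ∃ M ∈ L.Th, F ⊆ M ∧ c ∉ M := by
    intro c hc
    -- Theories over which no member of `F` yields `c`. Upward closure of `F` puts the least theory
    -- in `S`; a maximal member of `S` omits `c` and turns out to contain `F`.
    let S : Set (Set L.Expr) := {T | T ∈ L.Th ∧ ∀ f ∈ F, L.imp f c ∉ T}
    have hT₀ : ⋂₀ L.Th ∈ S := by
      refine ⟨L.sInter_mem _ subset_rfl L.th_nonempty, fun f hf h => hc (hup f hf c ?_)⟩
      exact fun T hT hfT => (imp_mem_iff hT).1 (h T hT) T hT subset_rfl hfT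
    obtain ⟨M, -, hM⟩ := zorn_subset_nonempty S (fun C hC hchain hCne => ⟨⋃₀ C,
      ⟨L.isIntuitionistic.closedUnderChains.sUnion_mem (fun T hT => (hC hT).1) hchain hCne,
        fun f hf ⟨T, hT, h⟩ => (hC hT).2 f hf h⟩, fun T hT => Set.subset_sUnion_of_mem hT⟩) _ hT₀
    have hMT : M ∈ L.Th := hM.prop.1
    refine ⟨M, hMT, fun g hg => ?_, fun h => ?_⟩
    -- The theory generated by `M` and `g` is still in `S`, since `F` is closed under conjunction;
    -- by maximality it is `M`. It exists, as otherwise `g → c` would lie in `M` vacuously.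
    · let 𝒯 : Set (Set L.Expr) := {T | T ∈ L.Th ∧ M ⊆ T ∧ g ∈ T}
      have h𝒯 : 𝒯.Nonempty := by
        by_contra hempty
        refine hM.prop.2 g hg ((imp_mem_iff hMT).2 fun T hT hMT hgT => ?_)
        exact absurd ⟨T, hT, hMT, hgT⟩ hempty
      have hMS : ⋂₀ 𝒯 ∈ S := by
        refine ⟨L.sInter_mem _ (fun T hT => hT.1) h𝒯, fun f hf h => ?_⟩
        refine hM.prop.2 _ (hand f hf g hg) ((imp_mem_iff hMT).2 fun T hT hMT hfg => ?_)
        have hfg' := (and_mem_iff hT).1 hfg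
        exact (imp_mem_iff hT).1 (h T ⟨hT, hMT, hfg'.2⟩) T hT subset_rfl hfg'.1
      rw [hM.eq_of_subset hMS (Set.subset_sInter fun T hT => hT.2.1)]
      exact fun T hT => hT.2.2
    · obtain ⟨f, hf⟩ := hne
      exact hM.prop.2 f hf ((imp_mem_iff hMT).2 fun T _ hMT _ => hMT h)
  have heq : F = ⋂₀ {M | M ∈ L.Th ∧ F ⊆ M} := by
    refine Set.Subset.antisymm (Set.subset_sInter fun M hM => hM.2) fun c hc => ?_
    by_contra hcF
    obtain ⟨M, hM, hFM, hcM⟩ := key c hcF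
    exact hcM (hc M ⟨hM, hFM⟩)
  rw [heq]
  obtain ⟨M, hM, hFM, -⟩ := key _ hbot
  exact L.sInter_mem _ (fun M hM => hM.1) ⟨M, hM, hFM⟩

end IL

/-! ## The space of an intuitionistic logic -/

theorem AbstractLogic.isOpen_basicOpen (L : AbstractLogic.{u}) (a : L.Expr) :
    IsOpen (L.basicOpen a) :=
  isOpen_generateFrom_of_mem ⟨a, rfl⟩

namespace IL

variable (L : IL.{u})

theorem basicOpen_and (a b : L.Expr) :
    L.basicOpen (L.and a b) = L.basicOpen a ∩ L.basicOpen b :=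
  Set.ext fun P => and_mem_iff P.2.mem_th

theorem basicOpen_or (a b : L.Expr) :
    L.basicOpen (L.or a b) = L.basicOpen a ∪ L.basicOpen b :=
  Set.ext fun P => or_mem_iff P.2

theorem basicOpen_bot : L.basicOpen L.bot = ∅ :=
  Set.eq_empty_of_forall_notMem fun P => bot_notMem P.2.mem_th

theorem basicOpen_imp_self (a : L.Expr) : L.basicOpen (L.imp a a) = Set.univ :=
  Set.eq_univ_of_forall fun P => imp_self_mem P.2.mem_th

theorem isTopologicalBasis_basicOpen : IsTopologicalBasis (Set.range L.basicOpen) := by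
  have h := isTopologicalBasis_of_subbasis_of_inter (r := Set.range L.basicOpen) rfl (by
    rintro _ ⟨a, rfl⟩ _ ⟨b, rfl⟩
    exact ⟨L.and a b, L.basicOpen_and a b⟩)
  rwa [Set.insert_eq_of_mem] at h
  obtain ⟨a⟩ := L.expr_nonempty
  exact ⟨_, L.basicOpen_imp_self a⟩

/-- By Alexander's subbasis theorem only covers by basic sets matter. If no finite subcover existed,
some prime theory would contain `a` and avoid all finitely covered formulas, yet it lies in a member
of the cover, whose formula is finitely covered. -/
theorem isCompact_basicOpen (a : L.Expr) : IsCompact (L.basicOpen a) := by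
  refine isCompact_generateFrom (S := Set.range L.basicOpen) rfl fun C hC hcover => ?_
  let J : Set L.Expr := {j | ∃ Q ⊆ C, Q.Finite ∧ L.basicOpen j ⊆ ⋃₀ Q}
  suffices a ∈ J from this
  by_contra ha
  have hJ : ∀ b ∈ J, ∀ c ∈ J, L.or b c ∈ J := by
    rintro b ⟨Q, hQ, hQf, hb⟩ c ⟨R, hR, hRf, hc⟩
    refine ⟨Q ∪ R, Set.union_subset hQ hR, hQf.union hRf, ?_⟩
    rw [basicOpen_or, Set.sUnion_union]
    exact Set.union_subset_union hb hc
  have hbot : L.bot ∈ J := ⟨∅, Set.empty_subset _, Set.finite_empty, by simp [basicOpen_bot]⟩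
  have hne : {T | T ∈ L.Th ∧ a ∈ T}.Nonempty := by
    by_contra h
    refine ha ⟨∅, Set.empty_subset _, Set.finite_empty, fun P hP => ?_⟩
    exact absurd ⟨P.1, P.2.mem_th, hP⟩ h
  obtain ⟨P, hP, haP, hdisj⟩ := exists_isPrime_disjoint hJ ⟨_, hbot⟩
    (L.sInter_mem _ (fun T hT => hT.1) hne) (Set.disjoint_left.2 fun j hj ⟨Q, hQ, hQf, h⟩ =>
      ha ⟨Q, hQ, hQf, fun P hP => h (hj P.1 ⟨P.2.mem_th, hP⟩)⟩)
  obtain ⟨V, hV, hPV⟩ := @hcover ⟨P, hP⟩ (haP fun T hT => hT.2)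
  obtain ⟨b, rfl⟩ := hC hV
  exact Set.disjoint_left.1 hdisj hPV
    ⟨{L.basicOpen b}, Set.singleton_subset_iff.2 hV, Set.finite_singleton _, by simp⟩

theorem range_basicOpen_eq : Set.range L.basicOpen = {U | IsCompact U ∧ IsOpen U} := by
  refine Set.Subset.antisymm ?_ fun U hU => ?_
  · rintro _ ⟨a, rfl⟩
    exact ⟨L.isCompact_basicOpen a, L.isOpen_basicOpen a⟩
  · obtain ⟨s, hs, rfl⟩ := (isCompact_open_iff_eq_finite_iUnion_of_isTopologicalBasis _
      L.isTopologicalBasis_basicOpen L.isCompact_basicOpen U).1 hU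
    clear hU
    induction s, hs using Set.Finite.induction_on with
    | empty => exact ⟨L.bot, by simp [basicOpen_bot]⟩
    | @insert a s _ _ ih =>
      obtain ⟨b, hb⟩ := ih
      exact ⟨L.or a b, by rw [basicOpen_or, hb, Set.biUnion_insert]⟩

variable {L}

theorem specializes_iff {P Q : L.Space} : Q ⤳ P ↔ P.1 ⊆ Q.1 := by
  rw [specializes_iff_mem_closure, L.isTopologicalBasis_basicOpen.mem_closure_iff]
  constructor
  · intro h a ha
    obtain ⟨_, hR, rfl⟩ := h _ ⟨a, rfl⟩ ha
    exact hR
  · rintro h _ ⟨a, rfl⟩ ha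
    exact ⟨Q, h ha, rfl⟩

/-- The deduction theorem ranges over all larger theories, the set on the right only over prime
ones; totally prime theories are prime and suffice to test membership. -/
theorem basicOpen_imp (a b : L.Expr) :
    L.basicOpen (L.imp a b) = impSet (L.basicOpen a) (L.basicOpen b) := by
  ext P
  refine (imp_mem_iff P.2.mem_th).trans ⟨fun h Q hQP => h Q.1 Q.2.mem_th (specializes_iff.1 hQP),
    fun h T hT hPT ha => ?_⟩
  exact mem_of_forall_isTotallyPrime hT fun M hM hTM =>
    h ⟨M, hM.isPrime⟩ (specializes_iff.2 (hPT.trans hTM)) (hTM ha)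

variable (L)

theorem t0Space : T0Space L.Space :=
  ⟨fun _ _ h => Subtype.ext (Set.Subset.antisymm (specializes_iff.1 h.symm.specializes)
    (specializes_iff.1 h.specializes))⟩

theorem quasiSober : QuasiSober L.Space where
  sober := by
    intro C hirr hC
    -- The union of the theories in `C`. Irreducibility makes it closed under conjunction, primeness
    -- of the points gives the disjunction property; it is the generic point.
    let F : Set L.Expr := {a | (C ∩ L.basicOpen a).Nonempty}
    have hbot : L.bot ∉ F := by simp [F, basicOpen_bot]
    have hF : F ∈ L.Th := by
      refine mem_th_of_isFilter ?_ hbot (fun a ha b hb => ?_) fun a ⟨P, hPC, ha⟩ b hab =>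
        ⟨P, hPC, hab _ P.2.mem_th ha⟩
      · obtain ⟨a⟩ := L.expr_nonempty
        exact ⟨L.imp a a, by simpa [F, basicOpen_imp_self] using hirr.nonempty⟩
      · simp only [F, Set.mem_ofPred_eq, basicOpen_and]
        exact hirr.2 _ _ (L.isOpen_basicOpen a) (L.isOpen_basicOpen b) ha hb
    have hprime : L.IsPrime F := isPrime_of_or_mem hF fun a b ⟨P, hPC, h⟩ =>
      ((or_mem_iff P.2).1 h).imp (fun h => ⟨P, hPC, h⟩) fun h => ⟨P, hPC, h⟩
    let p : L.Space := ⟨F, hprime⟩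
    refine ⟨p, Set.Subset.antisymm ?_ fun P hP => ?_⟩
    · refine closure_minimal (Set.singleton_subset_iff.2 ?_) hC
      rw [← hC.closure_eq]
      refine L.isTopologicalBasis_basicOpen.mem_closure_iff.2 ?_
      rintro _ ⟨a, rfl⟩ ⟨P, hPC, ha⟩
      exact ⟨P, ha, hPC⟩
    · exact specializes_iff_mem_closure.1 (specializes_iff.2 fun a ha => ⟨P, hP, ha⟩)

theorem implicativeSpectralSpace : ImplicativeSpectralSpace L.Space := by
  have hcompact : CompactSpace L.Space := by
    obtain ⟨a⟩ := L.expr_nonempty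
    exact ⟨L.basicOpen_imp_self a ▸ L.isCompact_basicOpen _⟩
  have himp : ∀ U V : CompactOpens L.Space, ∃ a, L.basicOpen a = impSet (U : Set L.Space) V := by
    intro U V
    obtain ⟨a, ha⟩ := L.range_basicOpen_eq.ge ⟨U.isCompact, U.isOpen⟩
    obtain ⟨b, hb⟩ := L.range_basicOpen_eq.ge ⟨V.isCompact, V.isOpen⟩
    exact ⟨L.imp a b, by rw [basicOpen_imp, ha, hb]⟩
  exact
    { L.t0Space, hcompact, L.quasiSober,
      QuasiSeparatedSpace.of_isTopologicalBasis L.isTopologicalBasis_basicOpen fun a b =>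
        L.basicOpen_and a b ▸ L.isCompact_basicOpen _,
      PrespectralSpace.of_isTopologicalBasis' L.isTopologicalBasis_basicOpen
        L.isCompact_basicOpen with
      isCompact_impSet := fun U V => by
        obtain ⟨a, ha⟩ := himp U V
        exact ha ▸ L.isCompact_basicOpen a
      isOpen_impSet := fun U V => by
        obtain ⟨a, ha⟩ := himp U V
        exact ha ▸ L.isOpen_basicOpen a }

theorem space_nonempty : Nonempty L.Space := by
  obtain ⟨T, hT⟩ := L.th_nonempty
  obtain ⟨M, hM, -⟩ := exists_isTotallyPrime_superset hT
  exact ⟨⟨M, hM.isPrime⟩⟩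

theorem isSpectralMap_pullback {L L' : IL.{u}} (h : StableMap L L') :
    IsSpectralMap h.pullback where
  toContinuous := continuous_generateFrom_iff.2 (by
    rintro _ ⟨a, rfl⟩
    exact L'.isOpen_basicOpen (h.1 a))
  isCompact_preimage_of_isOpen U ho hc := by
    obtain ⟨a, rfl⟩ := L.range_basicOpen_eq.ge ⟨hc, ho⟩
    exact L'.isCompact_basicOpen (h.1 a)

end IL

/-! ## The logic of a spectral space with implication -/

/-- A down-directed family of compact open sets none of which is covered by a member of an
up-directed one has a common point outside the latter. -/
theorem exists_mem_forall_notMem_of_directed {X : Type*} [TopologicalSpace X] [SpectralSpace X]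
    {F I : Set (CompactOpens X)} (hF : F.Nonempty) (hI : I.Nonempty)
    (hinf : ∀ U ∈ F, ∀ V ∈ F, U ⊓ V ∈ F) (hsup : ∀ U ∈ I, ∀ V ∈ I, U ⊔ V ∈ I)
    (h : ∀ U ∈ F, ∀ V ∈ I, ¬ U ≤ V) : ∃ x, (∀ U ∈ F, x ∈ U) ∧ ∀ V ∈ I, x ∉ V := by
  have : Nonempty (F × I) := ⟨⟨_, hF.some_mem⟩, ⟨_, hI.some_mem⟩⟩
  -- Differences of compact opens are closed in the compact constructible topology, so a directed
  -- family of non-empty ones has a common point.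
  let Z : F × I → Set (WithConstructibleTopology X) := fun p =>
    WithTopology.ofTopology ⁻¹' ((p.1.1 : Set X) \ p.2.1)
  have hZ : ∀ p, IsClosed (Z p) := by
    intro p
    have h := @IsOpen.union X _ _ (constructibleTopology X)
      (p.2.1.isCompact.isOpen_constructibleTopology_of_isOpen p.2.1.isOpen)
      (IsCompact.isOpen_constructibleTopology_of_isClosed (s := (p.1.1 : Set X)ᶜ)
        ((compl_compl (p.1.1 : Set X)).symm ▸ p.1.1.isCompact) p.1.1.isOpen.isClosed_compl)
    rw [WithConstructibleTopology.isClosed_iff]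
    exact (@isOpen_compl_iff X _ (constructibleTopology X)).1 (Set.compl_sdiff.symm ▸ h)
  obtain ⟨x, hx⟩ := IsCompact.nonempty_iInter_of_directed_nonempty_isCompact_isClosed Z
    (fun p q => ⟨⟨⟨p.1.1 ⊓ q.1.1, hinf _ p.1.2 _ q.1.2⟩, ⟨p.2.1 ⊔ q.2.1, hsup _ p.2.2 _ q.2.2⟩⟩,
      fun x hx => ⟨hx.1.1, fun h => hx.2 (Or.inl h)⟩,
      fun x hx => ⟨hx.1.2, fun h => hx.2 (Or.inr h)⟩⟩)
    (fun p => by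
      obtain ⟨x, hx, hx'⟩ := Set.not_subset.1 (h _ p.1.2 _ p.2.2)
      exact ⟨WithTopology.toTopology _ x, hx, hx'⟩)
    (fun p => (hZ p).isCompact) hZ
  rw [Set.mem_iInter] at hx
  exact ⟨x.ofTopology, fun U hU => (hx ⟨⟨U, hU⟩, ⟨_, hI.some_mem⟩⟩).1,
    fun V hV => (hx ⟨⟨_, hF.some_mem⟩, ⟨V, hV⟩⟩).2⟩

namespace SI

variable (X : SI.{u})

theorem pointFilter_mem_th (x : X.carrier) : X.pointFilter x ∈ X.logic.Th :=
  ⟨{X.pointFilter x}, Set.singleton_subset_iff.2 ⟨x, rfl⟩, Set.singleton_nonempty _,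
    Set.sInter_singleton _ |>.symm⟩

variable {X}

theorem exists_subset_pointFilter {T : Set X.Lam} (hT : T ∈ X.logic.Th) :
    ∃ x, T ⊆ X.pointFilter x := by
  obtain ⟨A, hA, ⟨P, hP⟩, rfl⟩ := hT
  obtain ⟨x, rfl⟩ := hA hP
  exact ⟨x, Set.sInter_subset_of_mem hP⟩

theorem exists_subset_pointFilter_notMem {T : Set X.Lam} (hT : T ∈ X.logic.Th) {U : X.Lam}
    (hU : U ∉ T) : ∃ x, T ⊆ X.pointFilter x ∧ U ∉ X.pointFilter x := by
  obtain ⟨A, hA, -, rfl⟩ := hT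
  obtain ⟨P, hP, hUP⟩ : ∃ P ∈ A, U ∉ P := by
    by_contra! h
    exact hU h
  obtain ⟨x, rfl⟩ := hA hP
  exact ⟨x, Set.sInter_subset_of_mem hP, hUP⟩

theorem mem_th_of_forall_exists {T : Set X.Lam} (hne : ∃ x, T ⊆ X.pointFilter x)
    (h : ∀ U ∉ T, ∃ x, T ⊆ X.pointFilter x ∧ U ∉ X.pointFilter x) : T ∈ X.logic.Th := by
  obtain ⟨x, hx⟩ := hne
  refine ⟨{P | P ∈ Set.range X.pointFilter ∧ T ⊆ P}, fun P hP => hP.1, ⟨_, ⟨x, rfl⟩, hx⟩,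
    Set.Subset.antisymm (Set.subset_sInter fun P hP => hP.2) fun U hU => ?_⟩
  by_contra hUT
  obtain ⟨y, hy, hUy⟩ := h U hUT
  exact hUy (hU _ ⟨⟨y, rfl⟩, hy⟩)

/-- The theories of the logic of `X` are the proper filters of compact open sets. -/
theorem mem_th_iff {T : Set X.Lam} : T ∈ X.logic.Th ↔
    T.Nonempty ∧ ⊥ ∉ T ∧ (∀ U ∈ T, ∀ V ∈ T, U ⊓ V ∈ T) ∧ ∀ U ∈ T, ∀ V, U ≤ V → V ∈ T := by
  constructor
  · intro hT
    obtain ⟨x, hx⟩ := exists_subset_pointFilter hT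
    obtain ⟨A, hA, -, rfl⟩ := hT
    refine ⟨⟨(⊤ : CompactOpens X.carrier), fun P hP => ?_⟩, fun h => hx h,
      fun U hU V hV P hP => ?_, fun U hU V hUV P hP => ?_⟩ <;> obtain ⟨y, rfl⟩ := hA hP
    · exact Set.mem_univ y
    · exact ⟨hU _ hP, hV _ hP⟩
    · exact hUV (hU _ hP)
  · rintro ⟨hne, hbot, hinf, hup⟩
    have key : ∀ U ∉ T, ∃ x, T ⊆ X.pointFilter x ∧ U ∉ X.pointFilter x := by
      intro U hU
      obtain ⟨x, hx, hx'⟩ := exists_mem_forall_notMem_of_directed (I := {U}) hne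
        (Set.singleton_nonempty U) hinf (by simp) fun V hV W hW hVW =>
          hU (hup V hV U (hVW.trans_eq hW))
      exact ⟨x, hx, hx' U rfl⟩
    obtain ⟨x, hx, -⟩ := key _ hbot
    exact mem_th_of_forall_exists ⟨x, hx⟩ key

/-- Being a proper filter is a finitary condition, hence survives unions of chains. -/
theorem logic_closedUnderChains : X.logic.ClosedUnderChains := by
  intro α hα T hT hmono
  have hT' := fun i => mem_th_iff.1 (hT i)
  refine mem_th_iff.2 ⟨?_, ?_, ?_, ?_⟩
  · obtain ⟨U, hU⟩ := (hT' ⟨0, hα⟩).1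
    exact ⟨U, Set.mem_iUnion.2 ⟨_, hU⟩⟩
  · intro h
    obtain ⟨i, hi⟩ := Set.mem_iUnion.1 h
    exact (hT' i).2.1 hi
  · intro U hU V hV
    obtain ⟨i, hi⟩ := Set.mem_iUnion.1 hU
    obtain ⟨j, hj⟩ := Set.mem_iUnion.1 hV
    rcases le_total i j with hij | hij
    · exact Set.mem_iUnion.2 ⟨j, (hT' j).2.2.1 U (hmono hij hi) V hj⟩
    · exact Set.mem_iUnion.2 ⟨i, (hT' i).2.2.1 U hi V (hmono hij hj)⟩
  · intro U hU V hUV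
    obtain ⟨i, hi⟩ := Set.mem_iUnion.1 hU
    exact Set.mem_iUnion.2 ⟨i, (hT' i).2.2.2 U hi V hUV⟩

theorem exists_pointFilter_eq_of_isTotallyPrime {T : Set X.Lam}
    (hT : X.logic.IsTotallyPrime T) : ∃ x, X.pointFilter x = T := by
  obtain ⟨A, hA, hne, heq⟩ := hT.mem_th
  refine hA (hT.mem_of_eq_sInter (fun P hP => ?_) hne heq)
  obtain ⟨x, rfl⟩ := hA hP
  exact X.pointFilter_mem_th x

theorem specializes_iff {x y : X.carrier} : y ⤳ x ↔ X.pointFilter x ⊆ X.pointFilter y := by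
  rw [specializes_iff_mem_closure,
    (PrespectralSpace.isTopologicalBasis (X := X.carrier)).mem_closure_iff]
  constructor
  · intro h U hU
    obtain ⟨_, hy, rfl⟩ := h _ ⟨U.isOpen, U.isCompact⟩ hU
    exact hy
  · intro h U hU hx
    exact ⟨y, @h (⟨⟨U, hU.2⟩, hU.1⟩ : CompactOpens X.carrier) hx, rfl⟩

variable (X)

theorem isIntuitionistic_logic : X.logic.IsIntuitionistic X.union X.inter X.neg X.imp where
  closedUnderChains := logic_closedUnderChains
  or_mem_iff U V T hT := by
    obtain ⟨x, rfl⟩ := exists_pointFilter_eq_of_isTotallyPrime hT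
    exact Iff.rfl
  and_mem_iff U V T hT := by
    obtain ⟨x, rfl⟩ := exists_pointFilter_eq_of_isTotallyPrime hT
    exact Iff.rfl
  neg_mem_iff U T hT := by
    obtain ⟨x, rfl⟩ := exists_pointFilter_eq_of_isTotallyPrime hT
    constructor
    · rintro h ⟨T', hT', hsub⟩
      obtain ⟨y, hy⟩ := exists_subset_pointFilter hT'
      exact h y (specializes_iff.2 ((Set.subset_union_left.trans hsub).trans hy))
        (hy (hsub (Or.inr rfl)))
    · intro h y hy hU
      exact absurd ⟨_, X.pointFilter_mem_th y, Set.union_subset (specializes_iff.1 hy)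
        (Set.singleton_subset_iff.2 hU)⟩ h
  imp_mem_iff U V T hT := by
    obtain ⟨x, rfl⟩ := exists_pointFilter_eq_of_isTotallyPrime hT
    constructor
    · intro h T' hT' hsub hU
      obtain ⟨y, rfl⟩ := exists_pointFilter_eq_of_isTotallyPrime hT'
      exact h y (specializes_iff.2 hsub) hU
    · intro h y hy hU
      by_contra hV
      -- The filter of `y` need not be totally prime, so it is first enlarged to a totally prime
      -- theory still omitting `V`.
      obtain ⟨M, hM, hyM, hVM⟩ := logic_closedUnderChains.exists_isTotallyPrime_notMem
        (X.pointFilter_mem_th y) (c := V) hV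
      exact hVM (h M hM ((specializes_iff.1 hy).trans hyM) (hyM hU))

/-- The logic of `X` as an object of `IL`. -/
def toIL : IL.{u} where
  toAbstractLogic := X.logic
  or := X.union
  and := X.inter
  neg := X.neg
  imp := X.imp
  expr_nonempty := ⟨(⊥ : X.Lam)⟩
  isIntuitionistic := X.isIntuitionistic_logic

variable {X}

/-- The prime theories of the logic of `X` are the filters of the points of `X`. -/
theorem isPrime_logic_iff {P : Set X.Lam} :
    X.logic.IsPrime P ↔ ∃ x, X.pointFilter x = P := by
  constructor
  · intro hP
    obtain ⟨hne, hbot, hinf, hup⟩ := mem_th_iff.1 hP.mem_th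
    -- The complement of a prime theory is closed under unions, so some point lies in exactly the
    -- members of `P`.
    obtain ⟨x, hx, hx'⟩ := exists_mem_forall_notMem_of_directed (F := P) (I := Pᶜ) hne ⟨⊥, hbot⟩
      hinf (fun U hU V hV h => ((IL.or_mem_iff (L := X.toIL) hP).1 h).elim hU hV)
      fun U hU V hV hUV => hV (hup U hU V hUV)
    refine ⟨x, Set.Subset.antisymm (fun U hU => ?_) hx⟩
    by_contra h
    exact hx' U h hU
  · rintro ⟨x, rfl⟩
    exact IL.isPrime_of_or_mem (L := X.toIL) (X.pointFilter_mem_th x) fun _ _ h => h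

/-- Pulling the filter of `x` back along `U' ↦ f⁻¹(U')` gives the filter of `f x`. -/
theorem isStable_preimage {X X' : SI.{u}} (f : X ⟶ X') :
    AbstractLogic.IsStable X'.logic X.logic (SI.preimage f) where
  isLogicMap T hT := by
    obtain ⟨x, hx⟩ := exists_subset_pointFilter hT
    refine mem_th_of_forall_exists ⟨toMap f x, fun U hU => hx hU⟩ fun U hU => ?_
    obtain ⟨y, hy, hUy⟩ := exists_subset_pointFilter_notMem hT hU
    exact ⟨toMap f y, fun V hV => hy hV, fun h => hUy h⟩
  isPrime_preimage P hP := by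
    obtain ⟨x, rfl⟩ := isPrime_logic_iff.1 hP
    exact isPrime_logic_iff.2 ⟨toMap f x, rfl⟩

theorem pointFilter_injective : Function.Injective X.pointFilter := fun _ _ h =>
  ((specializes_iff.2 h.ge).antisymm (specializes_iff.2 h.le)).eq

end SI

/-! ## The dual equivalence -/

theorem AbstractLogic.LogEquiv.refl (L : AbstractLogic.{u}) (a : L.Expr) : L.LogEquiv a a :=
  logEquiv_of_forall fun _ _ => Iff.rfl

namespace IL

/-- The space of `L` as an object of `SI`. -/
def toSI (L : IL.{u}) : SI.{u} :=
  @SI.mk L.Space _ L.space_nonempty L.implicativeSpectralSpace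

/-- The set `a^X` as a formula of the logic of the space of `L`. -/
def compactOpen (L : IL.{u}) (a : L.Expr) : L.toSI.Lam :=
  ⟨⟨L.basicOpen a, L.isCompact_basicOpen a⟩, L.isOpen_basicOpen a⟩

theorem compactOpen_surjective (L : IL.{u}) : Function.Surjective L.compactOpen := by
  intro U
  obtain ⟨a, ha⟩ := L.range_basicOpen_eq.ge ⟨U.isCompact, U.isOpen⟩
  exact ⟨a, SetLike.coe_injective ha⟩

variable {L : IL.{u}}

theorem preimage_compactOpen_mem_th {T : Set L.toSI.Lam} (hT : T ∈ L.toSI.logic.Th) :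
    L.compactOpen ⁻¹' T ∈ L.Th := by
  obtain ⟨A, hA, ⟨Q, hQ⟩, rfl⟩ := hT
  have heq : L.compactOpen ⁻¹' ⋂₀ A = ⋂₀ ((L.compactOpen ⁻¹' ·) '' A) := by
    simp [Set.sInter_eq_biInter, Set.preimage_iInter]
  rw [heq]
  refine L.sInter_mem _ ?_ ⟨_, Q, hQ, rfl⟩
  rintro _ ⟨R, hR, rfl⟩
  obtain ⟨P, rfl⟩ := hA hR
  exact P.2.mem_th

theorem isStable_compactOpen (L : IL.{u}) :
    AbstractLogic.IsStable L.toAbstractLogic L.toSI.logic L.compactOpen where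
  isLogicMap _ := preimage_compactOpen_mem_th
  isPrime_preimage Q hQ := by
    obtain ⟨P, rfl⟩ := SI.isPrime_logic_iff.1 hQ
    exact P.2

/-- `T` is the intersection of the prime theories above it, which are points of the space; the
intersection of their filters pulls back to `T`. -/
theorem exists_preimage_compactOpen_eq {T : Set L.Expr} (hT : T ∈ L.Th) :
    ∃ T' ∈ L.toSI.logic.Th, T = L.compactOpen ⁻¹' T' := by
  obtain ⟨M, hM, hTM⟩ := exists_isTotallyPrime_superset hT
  refine ⟨⋂₀ (L.toSI.pointFilter '' {P : L.Space | T ⊆ P.1}),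
    ⟨_, Set.image_subset_range _ _, ⟨_, ⟨M, hM.isPrime⟩, hTM, rfl⟩, rfl⟩, ?_⟩
  refine Set.Subset.antisymm ?_ fun a ha => ?_
  · rintro a ha _ ⟨P, hP, rfl⟩
    exact hP ha
  · exact mem_of_forall_isTotallyPrime hT fun N hN hTN =>
      ha _ ⟨(⟨N, hN.isPrime⟩ : L.Space), hTN, rfl⟩

theorem isLogicIso_compactOpen (L : IL.{u}) :
    AbstractLogic.IsLogicIso L.toAbstractLogic L.toSI.logic L.compactOpen where
  isLogicMap _ := preimage_compactOpen_mem_th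
  normal := by
    refine Set.Subset.antisymm ?_ fun T hT => exists_preimage_compactOpen_eq hT
    rintro _ ⟨T', hT', rfl⟩
    exact preimage_compactOpen_mem_th hT'
  surjective U := by
    obtain ⟨a, rfl⟩ := L.compactOpen_surjective U
    exact ⟨a, AbstractLogic.LogEquiv.refl _ _⟩

/-- The map `a ↦ a^X` as a stable map. -/
def toDoubleDual (L : IL.{u}) : StableMap L L.toSI.toIL :=
  ⟨L.compactOpen, L.isStable_compactOpen⟩

theorem preimage_surjInv_compactOpen {T : Set L.toSI.Lam} {T₀ : Set L.Expr}
    (h : T₀ = L.compactOpen ⁻¹' T) :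
    Function.surjInv L.compactOpen_surjective ⁻¹' T₀ = T := by
  subst h
  ext U
  simp [Function.surjInv_eq]

/-- A choice of representatives is a stable map inverse to `a ↦ a^X`. -/
noncomputable def ofDoubleDual (L : IL.{u}) : StableMap L.toSI.toIL L :=
  ⟨Function.surjInv L.compactOpen_surjective,
    { isLogicMap := fun T hT => by
        obtain ⟨T', hT', h⟩ := exists_preimage_compactOpen_eq hT
        exact (preimage_surjInv_compactOpen h).symm ▸ hT'
      isPrime_preimage := fun P hP => SI.isPrime_logic_iff.2
        ⟨(⟨P, hP⟩ : L.Space), (preimage_surjInv_compactOpen rfl).symm⟩ }⟩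

/-- The isomorphism between a logic and the logic of its space. -/
noncomputable def doubleDualIso (L : IL.{u}) : L ≅ L.toSI.toIL where
  hom := L.toDoubleDual.toHom
  inv := L.ofDoubleDual.toHom
  hom_inv_id := Quotient.sound fun a => AbstractLogic.logEquiv_of_forall fun T hT => by
    obtain ⟨T', hT', rfl⟩ := exists_preimage_compactOpen_eq hT
    have h := Function.surjInv_eq L.compactOpen_surjective (L.compactOpen a)
    exact iff_of_eq (congrArg (· ∈ T') h)
  inv_hom_id := Quotient.sound fun U => by
    have h : L.compactOpen (Function.surjInv L.compactOpen_surjective U) = U :=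
      Function.surjInv_eq L.compactOpen_surjective U
    change L.toSI.logic.LogEquiv (L.compactOpen (Function.surjInv L.compactOpen_surjective U)) U
    rw [h]
    exact AbstractLogic.LogEquiv.refl _ _

end IL

namespace SI

variable (X : SI.{u})

/-- The map `x ↦ x^Λ(X)` to the space of the logic of `X`. -/
def toSpace (x : X.carrier) : X.logic.Space := ⟨X.pointFilter x, isPrime_logic_iff.2 ⟨x, rfl⟩⟩

theorem toSpace_bijective : Function.Bijective X.toSpace :=
  ⟨fun _ _ h => pointFilter_injective (congrArg Subtype.val h), fun P =>
    (isPrime_logic_iff.1 P.2).imp fun _ h => Subtype.ext h⟩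

theorem isSpectralMap_toSpace : IsSpectralMap X.toSpace where
  toContinuous := continuous_generateFrom_iff.2 (by
    rintro _ ⟨U, rfl⟩
    exact CompactOpens.isOpen U)
  isCompact_preimage_of_isOpen S ho hc := by
    obtain ⟨U, rfl⟩ := X.toIL.range_basicOpen_eq.ge ⟨hc, ho⟩
    exact CompactOpens.isCompact U

/-- The bijection between the points of `X` and the prime theories of its logic. -/
noncomputable def equivSpace : X.carrier ≃ X.logic.Space :=
  Equiv.ofBijective X.toSpace X.toSpace_bijective

/-- Compact opens of `X` match basic opens of the space of its logic, so the inverse bijection is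
spectral as well. -/
theorem preimage_equivSpace_symm (U : X.Lam) :
    X.equivSpace.symm ⁻¹' (U : Set X.carrier) = X.logic.basicOpen U := by
  ext P
  obtain ⟨x, rfl⟩ := X.equivSpace.surjective P
  simp only [Set.mem_preimage, Equiv.symm_apply_apply]
  rfl

theorem isSpectralMap_equivSpace_symm : IsSpectralMap X.equivSpace.symm where
  toContinuous := (PrespectralSpace.isTopologicalBasis (X := X.carrier)).continuous_iff.2
    fun U hU => by
      have h := X.preimage_equivSpace_symm ⟨⟨U, hU.2⟩, hU.1⟩
      exact h ▸ X.logic.isOpen_basicOpen _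
  isCompact_preimage_of_isOpen U ho hc := by
    have h := X.preimage_equivSpace_symm ⟨⟨U, hc⟩, ho⟩
    exact h ▸ X.toIL.isCompact_basicOpen _

/-- The isomorphism between a space and the space of its logic. -/
noncomputable def doubleDualIso : X ≅ X.toIL.toSI where
  hom := SpectralMap.mk X.toSpace X.isSpectralMap_toSpace
  inv := SpectralMap.mk X.equivSpace.symm X.isSpectralMap_equivSpace_symm
  hom_inv_id := SpectralMap.ext X.equivSpace.symm_apply_apply
  inv_hom_id := SpectralMap.ext X.equivSpace.apply_symm_apply

theorem isHomeomorph_toSpace : IsHomeomorph X.toSpace :=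
  isHomeomorph_iff_exists_inverse.2 ⟨X.isSpectralMap_toSpace.continuous, X.equivSpace.symm,
    X.equivSpace.symm_apply_apply, X.equivSpace.apply_symm_apply,
    X.isSpectralMap_equivSpace_symm.continuous⟩

end SI

/-- The functor from logics to spaces. -/
def dualSpaceFunctor : IL.{u}ᵒᵖ ⥤ SI.{u} :=
  spaceFunctor IL.space_nonempty IL.implicativeSpectralSpace @IL.isSpectralMap_pullback

/-- The functor from spaces to logics. -/
def dualLogicFunctor : SI.{u} ⥤ IL.{u}ᵒᵖ :=
  logicFunctor SI.isIntuitionistic_logic @SI.isStable_preimage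

/-- The natural isomorphism with components `a ↦ a^X`. -/
noncomputable def logicIso : dualSpaceFunctor.{u} ⋙ dualLogicFunctor ≅ 𝟭 IL.{u}ᵒᵖ :=
  NatIso.ofComponents (fun L => L.unop.doubleDualIso.op) (by
    intro L L' f
    obtain ⟨f⟩ := f
    induction f using Quotient.ind
    rfl)

/-- The natural isomorphism with components `x ↦ x^Λ(X)`. -/
noncomputable def spaceIso : 𝟭 SI.{u} ≅ dualLogicFunctor ⋙ dualSpaceFunctor :=
  NatIso.ofComponents (fun X => X.doubleDualIso) (fun _ => rfl)

theorem mainTheorem1 :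
    ∃ (hne : ∀ L : IL.{u}, Nonempty L.Space)
      (hsp : ∀ L : IL.{u}, ImplicativeSpectralSpace L.Space)
      (hpull : ∀ (L L' : IL.{u}) (h : IL.StableMap L L'), IsSpectralMap h.pullback)
      (hint : ∀ X : SI.{u}, X.logic.IsIntuitionistic X.union X.inter X.neg X.imp)
      (hpre : ∀ (X X' : SI.{u}) (f : X ⟶ X'),
        AbstractLogic.IsStable X'.logic X.logic (SI.preimage f)),
      -- the sets `a^X` are a base of the space of a logic, and are exactly its compact open sets
      (∀ L : IL.{u}, IsTopologicalBasis (Set.range L.basicOpen) ∧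
        Set.range L.basicOpen = {U | IsCompact U ∧ IsOpen U}) ∧
      -- the two functors are mutually inverse equivalences
      (∃ e : IL.{u}ᵒᵖ ≌ SI.{u},
        e.functor = spaceFunctor hne hsp hpull ∧ e.inverse = logicFunctor hint hpre) ∧
      -- the natural isomorphism with components `τ_L : a ↦ a^{PTh_L}`, which are logic isomorphisms
      (∃ τ : spaceFunctor hne hsp hpull ⋙ logicFunctor hint hpre ≅ 𝟭 IL.{u}ᵒᵖ,
        ∀ L : IL.{u}, ∃ t : IL.StableMap L
            ((spaceFunctor hne hsp hpull ⋙ logicFunctor hint hpre).obj (op L)).unop,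
          (τ.hom.app (op L)).unop = t.toHom ∧
          (∀ a : L.Expr, SI.extent ((spaceFunctor hne hsp hpull).obj (op L)) (t.1 a) = L.basicOpen a) ∧
          AbstractLogic.IsLogicIso _ _ t.1) ∧
      -- the natural isomorphism with components `σ_X : x ↦ x^{Λ(X)}`, which are homeomorphisms
      (∃ σ : 𝟭 SI.{u} ≅ logicFunctor hint hpre ⋙ spaceFunctor hne hsp hpull,
        ∀ X : SI.{u},
          (∀ x : X.carrier, AbstractLogic.Space.theory (L := X.logic) (SI.toMap (σ.hom.app X) x) =
            X.pointFilter x) ∧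
          IsHomeomorph (SI.toMap (σ.hom.app X))) :=
  ⟨IL.space_nonempty, IL.implicativeSpectralSpace, @IL.isSpectralMap_pullback,
    SI.isIntuitionistic_logic, @SI.isStable_preimage,
    fun L => ⟨L.isTopologicalBasis_basicOpen, L.range_basicOpen_eq⟩,
    -- This construction may replace the unit to secure the triangle identity, while both functors
    -- stay as given; the explicit isomorphisms are supplied separately.
    ⟨CategoryTheory.Equivalence.mk dualSpaceFunctor dualLogicFunctor logicIso.symm spaceIso.symm,
      rfl, rfl⟩,
    ⟨logicIso, fun L => ⟨L.toDoubleDual, rfl, fun _ => rfl, L.isLogicIso_compactOpen⟩⟩,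
    ⟨spaceIso, fun X => ⟨fun _ => rfl, X.isHomeomorph_toSpace⟩⟩⟩
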